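/- Let $m\ge 0$ be an integer, let $\Sigma_{m+1}=\{0,1,\dots,m\}^{\mathbb N}$ be the space of one-sided sequences $\underline x=(x_1,x_2,\dots)$, let $\sigma(x_1,x_2,x_3,\dots)=(x_2,x_3,\dots)$ be the shift, and let $<$ be the lexicographic order on $\Sigma_{m+1}$. Fix a real number $\lambda>1$ and equip $\Sigma_{m+1}$ with the metric $$d_\lambda(\underline a,\underline b)=\sum_{i=1}^{\infty}\frac{|a_i-b_i|}{\lambda^i}.$$ For $\underline c\in\Sigma_{m+1}$ define $$M_{\underline c}=\{\underline x\in\Sigma_{m+1}:\ \sigma^n(\underline x)<\underline x\le\underline c\ \text{ for all } n>0\},\qquad M'_{\underline c}=\{\underline x\in\Sigma_{m+1}:\ \sigma^n(\underline x)\le\underline c\ \text{ for all } n\ge 0\}.$$ Then for every $\underline c\in\Sigma_{m+1}$ the two sets have the same Hausdorff dimension with respect to $d_\lambda$: $$\dim_H(M_{\underline c})=\dim_H(M'_{\underline c}).$$ (The Hausdorff dimension of the empty set is $0$.) -/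

import Mathlib

open scoped ENNReal

/-- The space `Σ_{m+1} = {0, 1, …, m}^ℕ` of one-sided sequences over the alphabet `{0, …, m}`.
The first letter is the one with index `0`. -/
def ShiftSpace (m : ℕ) : Type := ℕ → Fin (m + 1)

namespace ShiftSpace

/-- `Σ_{m+1}` carries the lexicographic order. -/
noncomputable instance instLinearOrder (m : ℕ) : LinearOrder (ShiftSpace m) :=
  inferInstanceAs (LinearOrder (Lex (ℕ → Fin (m + 1))))

theorem lt_iff {m : ℕ} (a b : ShiftSpace m) :
    a < b ↔ ∃ i : ℕ, (∀ j < i, a j = b j) ∧ a i < b i :=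
  Iff.rfl

/-- The shift map `σ`, which drops the first letter. -/
def shift {m : ℕ} (x : ShiftSpace m) : ShiftSpace m := fun i => x (i + 1)

theorem summable_aux {m : ℕ} {lam : ℝ} (hlam : 1 < lam) (a b : ShiftSpace m) :
    Summable fun i : ℕ => |((a i : ℕ) : ℝ) - ((b i : ℕ) : ℝ)| / lam ^ (i + 1) := by
  have h0 : 0 < lam := by linarith
  have hs : Summable fun i : ℕ => (m : ℝ) / lam * (lam⁻¹) ^ i :=
    (summable_geometric_of_lt_one (by positivity) (inv_lt_one_of_one_lt₀ hlam)).mul_left _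
  refine Summable.of_nonneg_of_le (fun i => by positivity) (fun i => ?_) hs
  have ha : ((a i : ℕ) : ℝ) ≤ m := by exact_mod_cast Nat.lt_succ_iff.1 (a i).2
  have hb : ((b i : ℕ) : ℝ) ≤ m := by exact_mod_cast Nat.lt_succ_iff.1 (b i).2
  have ha0 : (0 : ℝ) ≤ ((a i : ℕ) : ℝ) := Nat.cast_nonneg _
  have hb0 : (0 : ℝ) ≤ ((b i : ℕ) : ℝ) := Nat.cast_nonneg _
  have hab : |((a i : ℕ) : ℝ) - ((b i : ℕ) : ℝ)| ≤ m := by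
    rw [abs_le]; constructor <;> linarith
  calc |((a i : ℕ) : ℝ) - ((b i : ℕ) : ℝ)| / lam ^ (i + 1) ≤ (m : ℝ) / lam ^ (i + 1) := by
        gcongr
    _ = (m : ℝ) / lam * (lam⁻¹) ^ i := by
        rw [inv_pow, pow_succ]; field_simp

/-- The metric `d(a, b) = ∑_{i ≥ 1} |a_i - b_i| / lam ^ i` on `Σ_{m+1}`, for a base `lam > 1`
(with letters indexed from `1`, as in this formula, `a_i` is `a (i - 1)`). -/
@[reducible] noncomputable def metric (m : ℕ) {lam : ℝ} (hlam : 1 < lam) :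
    MetricSpace (ShiftSpace m) where
  dist a b := ∑' i : ℕ, |((a i : ℕ) : ℝ) - ((b i : ℕ) : ℝ)| / lam ^ (i + 1)
  dist_self a := by simp
  dist_comm a b := by simp only [abs_sub_comm]
  dist_triangle a b c := by
    have h0 : 0 < lam := by linarith
    rw [← (summable_aux hlam a b).tsum_add (summable_aux hlam b c)]
    refine (summable_aux hlam a c).tsum_le_tsum (fun i => ?_)
      ((summable_aux hlam a b).add (summable_aux hlam b c))
    rw [← add_div]
    gcongr
    exact abs_sub_le _ _ _
  eq_of_dist_eq_zero {a b} h := by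
    have h0 : 0 < lam := by linarith
    have h1 := (summable_aux hlam a b).hasSum
    rw [show ∑' i : ℕ, |((a i : ℕ) : ℝ) - ((b i : ℕ) : ℝ)| / lam ^ (i + 1) = 0 from h] at h1
    have h2 := (hasSum_zero_iff_of_nonneg (fun i => by positivity)).1 h1
    funext i
    have h3 : |((a i : ℕ) : ℝ) - ((b i : ℕ) : ℝ)| / lam ^ (i + 1) = 0 := congrFun h2 i
    rw [div_eq_zero_iff, abs_eq_zero, sub_eq_zero] at h3
    rcases h3 with h3 | h3
    · exact Fin.ext (by exact_mod_cast h3)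
    · exact absurd h3 (by positivity)

/-- Hausdorff dimension of a subset of `Σ_{m+1}` with respect to the metric of base `lam`. -/
noncomputable def hausdorffDim {m : ℕ} {lam : ℝ} (hlam : 1 < lam) (A : Set (ShiftSpace m)) :
    ℝ≥0∞ :=
  letI := metric m hlam
  dimH A

/-- A sequence `x` is kneading if `σ^n(x) < x` for all `n > 0`. -/
def IsKneading {m : ℕ} (x : ShiftSpace m) : Prop := ∀ n : ℕ, 0 < n → shift^[n] x < x

/-- `M_c = {x : σ^n(x) < x ≤ c for all n > 0}`. -/
def rightEndpoints {m : ℕ} (c : ShiftSpace m) : Set (ShiftSpace m) :=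
  {x | IsKneading x ∧ x ≤ c}

/-- `M_c' = {x : σ^n(x) ≤ c for all n ≥ 0}`. -/
def invariantBelow {m : ℕ} (c : ShiftSpace m) : Set (ShiftSpace m) :=
  {x | ∀ n : ℕ, shift^[n] x ≤ c}

end ShiftSpace

/-!
The inclusion `M_c ⊆ M_c'` gives one inequality. For the other, `c` may be replaced by the largest
element of `M_c'`, which changes neither set; afterwards `σ^n(c) ≤ c` for all `n`.

Let `wordsBelow c n` be the set of words of length `n` all of whose suffixes become strictly smaller
than `c` within the word. Two facts link these words to the two sets.

* Every prefix of an element of `M_c'` is a word of some `wordsBelow c j` followed by a prefix of `c`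
  (`exists_isBelow_append`). So if `wordsBelow c n` has at most `lam ^ (n * s)` elements for all `n`,
  then `M_c'` has `O(lam ^ (n * s))` prefixes of length `n`, and its dimension is at most `s`
  (`hausdorffDim_invariantBelow_le`).
* A prefix of `c` of length `L ≥ n`, a letter smaller than `c L`, and any concatenation of words of
  `wordsBelow c n` form an element of `M_c` (`mem_rightEndpoints_of_blocks`). So if for a single
  `n > 0` there are at least `lam ^ (n * s)` such words, then reading them as digits is a Hölder map
  of exponent `s` from a subset of `M_c` onto `[0, 1]`, and the dimension of `M_c` is at least `s`
  (`le_hausdorffDim_of_blocks`).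

For each `s > 0` one of the two cases occurs, which proves `dim M_c' ≤ dim M_c` whenever arbitrarily
large `L` with `c L ≠ 0` exist. If `c` is nonzero and ends in zeros, with last nonzero letter at
position `K`, then the periodic sequence `b` of period `c 0, …, c (K - 1), c K - 1` is below `c`, and
`M_c'` is contained in `M_b'` up to the countably many sequences that have a shift equal to `c`
(`exists_periodic_of_finite`); the result for `b` then gives the one for `c`.
-/

open scoped NNReal
open MeasureTheory Filter Topology

namespace ShiftSpace

variable {m : ℕ}

/-! ### Lexicographic comparison -/

theorem shift_iterate_apply (n : ℕ) (x : ShiftSpace m) (i : ℕ) : shift^[n] x i = x (n + i) := by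
  induction n generalizing x with
  | zero => simp
  | succ n ih =>
    rw [Function.iterate_succ_apply, ih]
    exact congrArg x (by omega)

theorem apply_le_of_le {x c : ShiftSpace m} (h : x ≤ c) {j : ℕ} (hj : ∀ l < j, x l = c l) :
    x j ≤ c j := by
  by_contra! hlt
  exact not_lt_of_ge h ((lt_iff _ _).2 ⟨j, fun l hl => (hj l hl).symm, hlt⟩)

theorem exists_first_ne {x y : ShiftSpace m} (h : x ≠ y) :
    ∃ j, (∀ l < j, x l = y l) ∧ x j ≠ y j := by
  have h' : ∃ j, x j ≠ y j := by
    by_contra! hc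
    exact h (funext hc)
  classical
  exact ⟨Nat.find h', fun l hl => not_not.1 (Nat.find_min h' hl), Nat.find_spec h'⟩

theorem le_of_forall_apply_le {x c : ShiftSpace m}
    (h : ∀ j, (∀ l < j, x l = c l) → x j ≤ c j) : x ≤ c := by
  by_contra! hlt
  obtain ⟨j, hj, hlt⟩ := (lt_iff _ _).1 hlt
  exact absurd (h j fun l hl => (hj l hl).symm) (not_le.2 hlt)

/-- The greedy choice of letters: every nonempty `A` is dominated, in the lexicographic order, by a
sequence each of whose prefixes occurs in `A`. -/
theorem exists_upperBound_prefix {A : Set (ShiftSpace m)} (hA : A.Nonempty) :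
    ∃ c : ShiftSpace m, (∀ n, ∃ y ∈ A, ∀ i < n, y i = c i) ∧ ∀ x ∈ A, x ≤ c := by
  have step : ∀ (x : A) (n : ℕ), ∃ y : A, (∀ i < n, y.1 i = x.1 i) ∧
      ∀ z : A, (∀ i < n, z.1 i = x.1 i) → z.1 n ≤ y.1 n := by
    intro x n
    obtain ⟨y, hy, hmax⟩ := Set.exists_max_image
      ((fun z : A => z.1 n) '' {z : A | ∀ i < n, z.1 i = x.1 i}) id (Set.toFinite _)
      ⟨_, x, fun _ _ => rfl, rfl⟩
    obtain ⟨y, hy, rfl⟩ := hy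
    exact ⟨y, hy, fun z hz => hmax _ ⟨z, hz, rfl⟩⟩
  choose F hF1 hF2 using step
  obtain ⟨a, ha⟩ := hA
  -- `p n` has the greedy prefix of length `n`
  let p : ℕ → A := fun n => Nat.rec ⟨a, ha⟩ (fun k y => F y k) n
  have hp : ∀ n, p (n + 1) = F (p n) n := fun n => rfl
  have hstab : ∀ n i, i < n → (p n).1 i = (p (i + 1)).1 i := by
    intro n
    induction n with
    | zero => intro i hi; omega
    | succ n ih =>
      intro i hi
      rcases Nat.lt_succ_iff_lt_or_eq.1 hi with h | rfl
      · rw [hp, hF1 _ _ i h, ih i h]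
      · rfl
  refine ⟨fun i => (p (i + 1)).1 i, fun n => ⟨(p n).1, (p n).2, fun i hi => hstab n i hi⟩,
    fun x hx => ?_⟩
  refine le_of_forall_apply_le fun j hj => ?_
  exact hF2 (p j) j ⟨x, hx⟩ fun i hi => (hj i hi).trans (hstab j i hi).symm

/-! ### Reduction to a bound that dominates its shifts -/

theorem invariantBelow_shift {c x : ShiftSpace m} (hx : x ∈ invariantBelow c) (n : ℕ) :
    shift^[n] x ∈ invariantBelow c := by
  intro k
  rw [← Function.iterate_add_apply]
  exact hx _

theorem rightEndpoints_subset_invariantBelow (c : ShiftSpace m) :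
    rightEndpoints c ⊆ invariantBelow c := by
  rintro x ⟨hx, hxc⟩ n
  rcases Nat.eq_zero_or_pos n with rfl | hn
  · exact hxc
  · exact (hx n hn).le.trans hxc

/-- The bound `c` may be replaced by the largest element of `M_c'`, which dominates its own
shifts, without changing either of the two sets. -/
theorem exists_selfMaximal (c : ShiftSpace m) :
    ∃ c' : ShiftSpace m, (∀ n, shift^[n] c' ≤ c') ∧ rightEndpoints c' = rightEndpoints c ∧
      invariantBelow c' = invariantBelow c := by
  have h0 : (invariantBelow c).Nonempty := by
    let z : ShiftSpace m := fun _ => 0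
    refine ⟨z, fun n => le_of_forall_apply_le fun j _ => ?_⟩
    rw [shift_iterate_apply]
    exact Fin.zero_le _
  obtain ⟨c', hpre, hub⟩ := exists_upperBound_prefix h0
  have hmem : c' ∈ invariantBelow c := by
    refine fun n => le_of_forall_apply_le fun j hj => ?_
    obtain ⟨y, hy, hyc⟩ := hpre (n + j + 1)
    simp only [shift_iterate_apply] at hj ⊢
    have h := apply_le_of_le (hy n) (j := j) fun l hl => by
      rw [shift_iterate_apply, hyc _ (by omega), hj l hl]
    rwa [shift_iterate_apply, hyc _ (by omega)] at h
  have hself : ∀ n, shift^[n] c' ≤ c' := fun n => hub _ (invariantBelow_shift hmem n)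
  have hle : c' ≤ c := hmem 0
  refine ⟨c', hself, ?_, ?_⟩
  · ext x
    refine ⟨fun h => ⟨h.1, h.2.trans hle⟩, fun h => ⟨h.1, ?_⟩⟩
    exact hub _ (rightEndpoints_subset_invariantBelow c h)
  · ext x
    exact ⟨fun h n => (h n).trans hle, fun h n => hub _ (invariantBelow_shift h n)⟩

/-! ### Words below the bound -/

/-- Every suffix of the prefix of length `n` of `x` is smaller than `c`, and a letter inside that
prefix witnesses this. The property depends only on the first `n` letters of `x`, and words that
have it may be concatenated freely. -/
def IsBelow (c : ShiftSpace m) (n : ℕ) (x : ShiftSpace m) : Prop :=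
  ∀ i < n, ∃ j, i + j < n ∧ (∀ l < j, x (i + l) = c l) ∧ x (i + j) < c j

theorem IsBelow.congr {c x y : ShiftSpace m} {n : ℕ} (hx : IsBelow c n x)
    (h : ∀ i < n, y i = x i) : IsBelow c n y := by
  intro i hi
  obtain ⟨j, hj, heq, hlt⟩ := hx i hi
  exact ⟨j, hj, fun l hl => by rw [h _ (by omega), heq l hl], by rwa [h _ hj]⟩

/-- The prefix of length `n`. -/
def take (n : ℕ) (x : ShiftSpace m) : Fin n → Fin (m + 1) := fun i => x i

/-- The words of length `n` all of whose suffixes are strictly smaller than `c`. -/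
def wordsBelow (c : ShiftSpace m) (n : ℕ) : Set (Fin n → Fin (m + 1)) :=
  take n '' {x | IsBelow c n x}

/-- Each prefix of a sequence in `M_c'` is a word of `wordsBelow` followed by a prefix of `c`. The
first position from which the prefix of `x` agrees with `c` marks the border. -/
theorem exists_isBelow_append {c x : ShiftSpace m} (hc : ∀ n, shift^[n] c ≤ c)
    (hx : x ∈ invariantBelow c) (n : ℕ) :
    ∃ j ≤ n, IsBelow c j x ∧ ∀ l, j + l < n → x (j + l) = c l := by
  classical
  have hex : ∃ j, ∀ l, j + l < n → x (j + l) = c l := ⟨n, fun l hl => by omega⟩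
  refine ⟨Nat.find hex, Nat.find_min' hex fun l hl => by omega, ?_, Nat.find_spec hex⟩
  set j := Nat.find hex with hj
  intro i hi
  have hne : shift^[i] x ≠ c := by
    intro h
    refine Nat.find_min hex hi fun l _ => ?_
    rw [← h, shift_iterate_apply]
  obtain ⟨p, hp, hpn⟩ := exists_first_ne hne
  have hlt : x (i + p) < c p := by
    have := lt_of_le_of_ne (apply_le_of_le (hx i) hp) hpn
    rwa [shift_iterate_apply] at this
  simp only [shift_iterate_apply] at hp hpn
  refine ⟨p, ?_, hp, hlt⟩
  have hpn' : i + p < n := by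
    by_contra! hge
    exact Nat.find_min hex hi fun l hl => hp l (by omega)
  -- Past `j` the sequence `x` copies `c` from its start, which dominates its own shifts, so a
  -- letter smaller than the corresponding one of `c` cannot come first there.
  by_contra! hge
  have hcx : ∀ l, j + l < n → x (j + l) = c l := Nat.find_spec hex
  have h := apply_le_of_le (hc (j - i)) (j := i + p - j) fun l hl => by
    rw [shift_iterate_apply, ← hp _ (by omega), ← hcx l (by omega)]
    exact congrArg x (by omega)
  rw [shift_iterate_apply, ← hcx (i + p - j) (by omega), show j - i + (i + p - j) = p by omega,
    show j + (i + p - j) = i + p by omega] at h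
  exact absurd h (not_le.2 hlt)

/-- If `c` dominates its own shifts and `y` falls below `c` at position `L` for the first time, then
each suffix of `y` that starts before or at `L` falls below `c` no later than at `L`. -/
theorem exists_lt_of_lowered {c y : ShiftSpace m} (hc : ∀ n, shift^[n] c ≤ c) {L p : ℕ}
    (hhead : ∀ i < L, y i = c i) (hL : y L < c L) (hp : p ≤ L) :
    ∃ j ≤ L - p, (∀ l < j, y (p + l) = c l) ∧ y (p + j) < c j := by
  have hlow : ∀ j, (∀ l < j, c (p + l) = c l) → c (p + j) ≤ c j := fun j hj => by
    have h := apply_le_of_le (hc p) (j := j) fun l hl => by rw [shift_iterate_apply, hj l hl]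
    rwa [shift_iterate_apply] at h
  by_cases hall : ∀ l, p + l < L → c (p + l) = c l
  · refine ⟨L - p, le_rfl, fun l hl => ?_, ?_⟩
    · rw [hhead _ (by omega), hall l (by omega)]
    · have h := hlow (L - p) fun l hl => hall l (by omega)
      rw [show p + (L - p) = L by omega] at h ⊢
      exact hL.trans_le h
  · push Not at hall
    classical
    have hspec := Nat.find_spec hall
    have hmin : ∀ l < Nat.find hall, c (p + l) = c l := fun l hl => by
      by_contra hne
      exact Nat.find_min hall hl ⟨by omega, hne⟩
    refine ⟨Nat.find hall, by omega, fun l hl => ?_, ?_⟩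
    · rw [hhead _ (by omega), hmin l hl]
    · rw [hhead _ hspec.1]
      exact lt_of_le_of_ne (hlow _ hmin) hspec.2

/-- A prefix of `c` of length `L ≥ n`, followed by a letter smaller than `c L`, followed by words of
`wordsBelow c n`, is a kneading sequence below `c`: the long head is larger than everything that can
be seen in any later window. -/
theorem mem_rightEndpoints_of_blocks {c x : ShiftSpace m} (hc : ∀ n, shift^[n] c ≤ c) {n L : ℕ}
    (hn : 0 < n) (hnL : n ≤ L) (hhead : ∀ i < L, x i = c i) (hL : x L < c L)
    (hblocks : ∀ k, IsBelow c n (shift^[L + 1 + k * n] x)) : x ∈ rightEndpoints c := by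
  have key : ∀ p, 0 < p → ∃ j < L, (∀ l < j, x (p + l) = c l) ∧ x (p + j) < c j := by
    intro p hp
    rcases Nat.lt_or_ge L p with hpL | hpL
    · have hdm := Nat.div_add_mod' (p - (L + 1)) n
      set k := (p - (L + 1)) / n
      set i := (p - (L + 1)) % n
      obtain ⟨j, hj, heq, hlt⟩ := hblocks k i (Nat.mod_lt _ hn)
      simp only [shift_iterate_apply] at heq hlt
      refine ⟨j, by omega, fun l hl => ?_, ?_⟩
      · rw [← heq l hl]
        exact congrArg x (by omega)
      · rwa [show p + j = L + 1 + k * n + (i + j) by omega]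
    · obtain ⟨j, hj, heq, hlt⟩ := exists_lt_of_lowered hc hhead hL hpL
      exact ⟨j, by omega, heq, hlt⟩
  refine ⟨fun p hp => ?_, ((lt_iff _ _).2 ⟨L, hhead, hL⟩).le⟩
  obtain ⟨j, hj, heq, hlt⟩ := key p hp
  refine (lt_iff _ _).2 ⟨j, fun l hl => ?_, ?_⟩
  · rw [shift_iterate_apply, heq l hl, hhead l (by omega)]
  · rw [shift_iterate_apply, hhead j hj]
    exact hlt

/-! ### The metric -/

theorem inv_pow_le_dist {lam : ℝ} (hlam : 1 < lam) {x y : ShiftSpace m} {n : ℕ} (h : x n ≠ y n) :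
    letI := metric m hlam
    (lam ^ (n + 1))⁻¹ ≤ dist x y := by
  have h0 : 0 < lam := by linarith
  have h1 : (1 : ℝ) ≤ |((x n : ℕ) : ℝ) - ((y n : ℕ) : ℝ)| := by
    have hne : ((x n : ℕ) : ℤ) - ((y n : ℕ) : ℤ) ≠ 0 := by
      rw [sub_ne_zero]
      exact fun he => h (Fin.ext (by exact_mod_cast he))
    exact_mod_cast Int.one_le_abs hne
  calc (lam ^ (n + 1))⁻¹ = 1 / lam ^ (n + 1) := by rw [one_div]
    _ ≤ |((x n : ℕ) : ℝ) - ((y n : ℕ) : ℝ)| / lam ^ (n + 1) := by gcongr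
    _ ≤ _ := (summable_aux hlam x y).le_tsum n fun i _ => by positivity

theorem dist_le_of_agree {lam : ℝ} (hlam : 1 < lam) {x y : ShiftSpace m} {n : ℕ}
    (h : ∀ i < n, x i = y i) :
    letI := metric m hlam
    dist x y ≤ m / (lam - 1) * (lam ^ n)⁻¹ := by
  have h0 : 0 < lam := by linarith
  have h1 : lam - 1 ≠ 0 := by linarith
  change ∑' i : ℕ, |((x i : ℕ) : ℝ) - ((y i : ℕ) : ℝ)| / lam ^ (i + 1) ≤ _
  have hsum := summable_aux hlam x y
  rw [← hsum.sum_add_tsum_nat_add n, Finset.sum_eq_zero, zero_add]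
  swap
  · intro i hi
    rw [h i (Finset.mem_range.1 hi)]
    simp
  have hgeo : HasSum (fun i : ℕ => (m : ℝ) / (lam * lam ^ n) * lam⁻¹ ^ i)
      (m / (lam * lam ^ n) * (1 - lam⁻¹)⁻¹) :=
    (hasSum_geometric_of_lt_one (by positivity) (inv_lt_one_of_one_lt₀ hlam)).mul_left _
  have hval : (m : ℝ) / (lam * lam ^ n) * (1 - lam⁻¹)⁻¹ = m / (lam - 1) * (lam ^ n)⁻¹ := by
    have : 1 - lam⁻¹ ≠ 0 := by
      have := inv_lt_one_of_one_lt₀ hlam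
      linarith
    field_simp
  rw [← hval, ← hgeo.tsum_eq]
  refine ((summable_nat_add_iff n).2 hsum).tsum_le_tsum (fun i => ?_) hgeo.summable
  have hab : |((x (i + n) : ℕ) : ℝ) - ((y (i + n) : ℕ) : ℝ)| ≤ m := by
    have ha : ((x (i + n) : ℕ) : ℝ) ≤ m := by exact_mod_cast Nat.lt_succ_iff.1 (x (i + n)).2
    have hb : ((y (i + n) : ℕ) : ℝ) ≤ m := by exact_mod_cast Nat.lt_succ_iff.1 (y (i + n)).2
    have ha0 : (0 : ℝ) ≤ ((x (i + n) : ℕ) : ℝ) := Nat.cast_nonneg _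
    have hb0 : (0 : ℝ) ≤ ((y (i + n) : ℕ) : ℝ) := Nat.cast_nonneg _
    rw [abs_le]; constructor <;> linarith
  calc _ ≤ (m : ℝ) / lam ^ (i + n + 1) := by gcongr
    _ = _ := by
        rw [inv_pow]
        field_simp
        ring

/-! ### Bounds for the dimension from counts of words -/

/-- If freely chosen blocks of length `n` from a set of at least `lam ^ (n * s)` words can be
prescribed inside `A` from position `p` on, then `A` has dimension at least `s`: reading the blocks
as digits maps `A` onto `[0, 1]`, and this map is Hölder continuous of exponent `s`. -/
theorem le_hausdorffDim_of_blocks {lam : ℝ} (hlam : 1 < lam) {s : ℝ≥0} (hs : 0 < s) {n p : ℕ}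
    (hn : 0 < n) (G : Set (Fin n → Fin (m + 1))) (hG : lam ^ ((n : ℝ) * s) ≤ Nat.card G)
    {A : Set (ShiftSpace m)}
    (hA : ∀ w : ℕ → G, ∃ x ∈ A, ∀ k, take n (shift^[p + k * n] x) = w k) :
    (s : ℝ≥0∞) ≤ hausdorffDim hlam A := by
  classical
  let := metric m hlam
  change (s : ℝ≥0∞) ≤ dimH A
  have h0 : 0 < lam := by linarith
  set Q := Nat.card G with hQ
  have hQ1 : 1 < Q := by
    have : (1 : ℝ) < lam ^ ((n : ℝ) * s) := Real.one_lt_rpow hlam (by positivity)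
    exact_mod_cast this.trans_le hG
  let e : G ≃ Fin Q := Finite.equivFin G
  let digit : ShiftSpace m → ℕ → Fin Q := fun x k =>
    if h : take n (shift^[p + k * n] x) ∈ G then e ⟨_, h⟩ else ⟨0, by omega⟩
  let f : ShiftSpace m → ℝ := fun x => Real.ofDigits (digit x)
  have hsurj : Set.Icc (0 : ℝ) 1 ⊆ f '' A := by
    intro r hr
    obtain ⟨d, -, rfl⟩ := Real.ofDigits_SurjOn hQ1 hr
    obtain ⟨x, hxA, hx⟩ := hA fun k => e.symm (d k)
    refine ⟨x, hxA, congrArg Real.ofDigits (funext fun k => ?_)⟩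
    have hmem : take n (shift^[p + k * n] x) ∈ G := by
      rw [hx k]
      exact (e.symm (d k)).2
    have : (⟨_, hmem⟩ : G) = e.symm (d k) := Subtype.ext (hx k)
    simp only [digit, hmem, dif_pos, this, Equiv.apply_symm_apply]
  have hdist : ∀ x y, dist (f x) (f y) ≤ lam ^ ((s : ℝ) * (p + n + 1)) * dist x y ^ (s : ℝ) := by
    intro x y
    rcases eq_or_ne x y with rfl | hxy
    · rw [dist_self]
      positivity
    obtain ⟨N, hN, hNne⟩ := exists_first_ne hxy
    have hj := Nat.div_add_mod (N - p) n
    have hjlt := Nat.mod_lt (N - p) hn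
    -- `j` blocks end before the first difference `N`; the truncated `N - p` makes this `0` if `N < p`
    set j := (N - p) / n with hjdef
    have hagree : ∀ k < j, digit x k = digit y k := by
      intro k hk
      have hkj : k * n + n ≤ n * j := by
        calc k * n + n = n * (k + 1) := by ring
          _ ≤ n * j := Nat.mul_le_mul_left _ hk
      have : take n (shift^[p + k * n] x) = take n (shift^[p + k * n] y) := by
        funext i
        simp only [take, shift_iterate_apply]
        exact hN _ (by have := i.2; omega)
      simp only [digit, this]
    have hlow := inv_pow_le_dist hlam hNne
    have hexp : (s : ℝ) * (N - p - n) ≤ (n : ℝ) * s * j := by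
      have : (N : ℝ) ≤ p + n + n * j := by
        have : N ≤ p + n + n * j := by omega
        exact_mod_cast this
      have hs' : (0 : ℝ) ≤ s := s.coe_nonneg
      nlinarith
    calc dist (f x) (f y) ≤ ((Q : ℝ) ^ j)⁻¹ := Real.abs_ofDigits_sub_ofDigits_le hagree
      _ ≤ ((lam ^ ((n : ℝ) * s)) ^ j)⁻¹ := by gcongr
      _ = (lam ^ ((n : ℝ) * s * j))⁻¹ := by rw [← Real.rpow_mul_natCast h0.le]
      _ ≤ (lam ^ ((s : ℝ) * (N - p - n)))⁻¹ := by
          gcongr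
          exact hlam.le
      _ = lam ^ ((s : ℝ) * (p + n + 1)) * ((lam ^ (N + 1))⁻¹) ^ (s : ℝ) := by
          rw [← Real.rpow_neg h0.le, ← Real.rpow_natCast, ← Real.rpow_neg h0.le,
            ← Real.rpow_mul h0.le, ← Real.rpow_add h0]
          congr 1
          push_cast
          ring
      _ ≤ _ := by gcongr
  have hf : HolderWith (Real.toNNReal (lam ^ ((s : ℝ) * (p + n + 1)))) s f := by
    intro x y
    rw [edist_dist, edist_dist, ENNReal.ofReal_rpow_of_nonneg dist_nonneg s.coe_nonneg]
    change _ ≤ ENNReal.ofReal _ * _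
    rw [← ENNReal.ofReal_mul (by positivity)]
    exact ENNReal.ofReal_le_ofReal (hdist x y)
  have h1 : dimH (Set.Icc (0 : ℝ) 1) = 1 := by
    rw [Real.dimH_of_nonempty_interior] <;> simp
  have h2 : (1 : ℝ≥0∞) ≤ dimH A / s := by
    rw [← h1]
    exact (dimH_mono hsurj).trans (hf.dimH_image_le hs A)
  have hs0 : (s : ℝ≥0∞) ≠ 0 := by exact_mod_cast hs.ne'
  rwa [ENNReal.le_div_iff_mul_le (Or.inl hs0) (Or.inl ENNReal.coe_ne_top), one_mul] at h2

/-- The dimension of a set is bounded by the exponential growth rate of the number of sets, of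
exponentially decaying diameter, that are needed to cover it. -/
theorem dimH_le_of_finite_covers {X : Type*} [EMetricSpace X] {A : Set X} {s : ℝ≥0} {lam : ℝ}
    (hlam : 1 < lam) {C D : ℝ} (hD : 0 ≤ D) (ι : ℕ → Type*) [∀ n, Fintype (ι n)]
    (t : ∀ n, ι n → Set X)
    (hdiam : ∀ n i, Metric.ediam (t n i) ≤ ENNReal.ofReal (D * (lam ^ n)⁻¹))
    (hcover : ∀ n, A ⊆ ⋃ i, t n i)
    (hcard : ∀ n, (Fintype.card (ι n) : ℝ) ≤ C * (lam ^ (s : ℝ)) ^ n) : dimH A ≤ s := by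
  borelize X
  have h0 : 0 < lam := by linarith
  refine dimH_le_of_hausdorffMeasure_ne_top ?_
  have hr : Tendsto (fun n : ℕ => ENNReal.ofReal (D * (lam ^ n)⁻¹)) atTop (𝓝 0) := by
    rw [← ENNReal.ofReal_zero]
    refine ENNReal.tendsto_ofReal ?_
    have := (tendsto_pow_atTop_nhds_zero_of_lt_one (inv_nonneg.2 h0.le)
      (inv_lt_one_of_one_lt₀ hlam)).const_mul D
    simpa using this
  refine ne_top_of_le_ne_top (ENNReal.ofReal_ne_top (r := C * D ^ (s : ℝ))) <|
    (Measure.hausdorffMeasure_le_liminf_sum s A _ hr t (Eventually.of_forall hdiam)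
      (Eventually.of_forall hcover)).trans ?_
  refine (liminf_le_liminf (Eventually.of_forall fun n => ?_)).trans
    (liminf_const (f := (atTop : Filter ℕ)) (ENNReal.ofReal (C * D ^ (s : ℝ)))).le
  calc ∑ i, Metric.ediam (t n i) ^ (s : ℝ)
      ≤ ∑ _i : ι n, ENNReal.ofReal ((D * (lam ^ n)⁻¹) ^ (s : ℝ)) := by
        refine Finset.sum_le_sum fun i _ => ?_
        rw [← ENNReal.ofReal_rpow_of_nonneg (by positivity) s.coe_nonneg]
        exact ENNReal.rpow_le_rpow (hdiam n i) s.coe_nonneg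
    _ = ENNReal.ofReal (Fintype.card (ι n) * (D * (lam ^ n)⁻¹) ^ (s : ℝ)) := by
        rw [Finset.sum_const, Finset.card_univ, nsmul_eq_mul, ENNReal.ofReal_mul (by positivity),
          ENNReal.ofReal_natCast]
    _ ≤ ENNReal.ofReal (C * D ^ (s : ℝ)) := by
        refine ENNReal.ofReal_le_ofReal ?_
        calc _ ≤ C * (lam ^ (s : ℝ)) ^ n * (D * (lam ^ n)⁻¹) ^ (s : ℝ) := by
              gcongr
              exact hcard n
          _ = C * D ^ (s : ℝ) := by
              rw [Real.mul_rpow hD (by positivity), Real.inv_rpow (by positivity),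
                ← Real.rpow_natCast, ← Real.rpow_natCast, ← Real.rpow_mul h0.le,
                ← Real.rpow_mul h0.le, mul_comm (n : ℝ)]
              have : (0 : ℝ) < lam ^ ((s : ℝ) * n) := by positivity
              field_simp

/-- If `wordsBelow c n` has at most `lam ^ (n * s)` elements for all `n`, then there are at most
`C * lam ^ (n * s)` prefixes of length `n` in `M_c'`, whose dimension is therefore at most `s`. -/
theorem hausdorffDim_invariantBelow_le {lam : ℝ} (hlam : 1 < lam) {s : ℝ≥0} (hs : 0 < s)
    {c : ShiftSpace m} (hc : ∀ n, shift^[n] c ≤ c)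
    (hcard : ∀ n, (Nat.card (wordsBelow c n) : ℝ) ≤ (lam ^ (s : ℝ)) ^ n) :
    hausdorffDim hlam (invariantBelow c) ≤ s := by
  classical
  let := metric m hlam
  change dimH (invariantBelow c) ≤ s
  have h0 : 0 < lam := by linarith
  have h1 : 0 < lam - 1 := by linarith
  have hρ : 1 < lam ^ (s : ℝ) := Real.one_lt_rpow hlam (by exact_mod_cast hs)
  set ρ := lam ^ (s : ℝ) with hρdef
  have hρ1 : 0 < ρ - 1 := by linarith
  let : ∀ j, Fintype (wordsBelow c j) := fun j => Fintype.ofFinite _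
  refine dimH_le_of_finite_covers (D := m / (lam - 1)) (C := ρ / (ρ - 1)) hlam (by positivity)
    (fun n => Σ j : Fin (n + 1), wordsBelow c j)
    (fun n i => {x | take i.1 x = i.2.1 ∧ ∀ l, (i.1 : ℕ) + l < n → x (i.1 + l) = c l}) ?_ ?_ ?_
  · intro n i
    refine Metric.ediam_le fun x hx y hy => ?_
    rw [edist_dist]
    refine ENNReal.ofReal_le_ofReal (dist_le_of_agree hlam fun k hk => ?_)
    rcases Nat.lt_or_ge k i.1 with hki | hki
    · exact congrFun (hx.1.trans hy.1.symm) ⟨k, hki⟩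
    · obtain ⟨l, rfl⟩ := Nat.exists_eq_add_of_le hki
      rw [hx.2 l hk, hy.2 l hk]
  · intro n x hx
    obtain ⟨j, hj, hbelow, htail⟩ := exists_isBelow_append hc hx n
    exact Set.mem_iUnion.2 ⟨⟨⟨j, by omega⟩, ⟨take j x, x, hbelow, rfl⟩⟩, rfl, htail⟩
  · intro n
    rw [Fintype.card_sigma]
    push_cast
    calc ∑ j : Fin (n + 1), (Fintype.card (wordsBelow c j) : ℝ)
        ≤ ∑ j : Fin (n + 1), ρ ^ (j : ℕ) := by
          refine Finset.sum_le_sum fun j _ => ?_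
          rw [← Nat.card_eq_fintype_card]
          exact hcard j
      _ = (ρ ^ (n + 1) - 1) / (ρ - 1) := by
          rw [Fin.sum_univ_eq_sum_range fun j => ρ ^ j, geom_sum_eq hρ.ne']
      _ ≤ ρ / (ρ - 1) * ρ ^ n := by
          rw [div_mul_eq_mul_div, pow_succ']
          gcongr
          linarith

/-- If `c` dominates its own shifts and does not end in zeros, then `M_c` is large enough. A head of
`c` that is longer than the blocks makes every concatenation of words of `wordsBelow c n` the tail
of an element of `M_c`. -/
theorem hausdorffDim_invariantBelow_le_of_frequently {lam : ℝ} (hlam : 1 < lam) {c : ShiftSpace m}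
    (hc : ∀ n, shift^[n] c ≤ c) (hinf : ∀ n, ∃ L, n ≤ L ∧ 0 < c L) :
    hausdorffDim hlam (invariantBelow c) ≤ hausdorffDim hlam (rightEndpoints c) := by
  refine ENNReal.le_of_forall_nnreal_lt fun s hs => ?_
  rcases eq_zero_or_pos s with rfl | hs0
  · exact zero_le
  by_contra hlt
  refine absurd (hausdorffDim_invariantBelow_le hlam hs0 hc fun n => ?_) (not_le.2 hs)
  rcases Nat.eq_zero_or_pos n with rfl | hn
  · rw [pow_zero]
    exact_mod_cast Finite.card_le_one_iff_subsingleton.2 inferInstance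
  by_contra! hcard
  obtain ⟨L, hnL, hL⟩ := hinf n
  refine hlt (le_hausdorffDim_of_blocks (p := L + 1) hlam hs0 hn (wordsBelow c n) ?_ ?_)
  · rw [mul_comm, Real.rpow_mul_natCast (by linarith)]
    exact hcard.le
  intro w
  let x : ShiftSpace m := fun i =>
    if i < L then c i else if i = L then 0 else
      (w ((i - (L + 1)) / n)).1 ⟨(i - (L + 1)) % n, Nat.mod_lt _ hn⟩
  have hx : ∀ k, take n (shift^[L + 1 + k * n] x) = w k := by
    intro k
    funext i
    have h1 : L + 1 + k * n + i - (L + 1) = i + k * n := by omega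
    have h2 : (i + k * n) / n = k := by
      rw [Nat.add_mul_div_right _ _ hn, Nat.div_eq_of_lt i.2, zero_add]
    have h3 : (i + k * n) % n = i := by
      rw [Nat.add_mul_mod_self_right, Nat.mod_eq_of_lt i.2]
    refine (shift_iterate_apply _ x i).trans ?_
    change (if L + 1 + k * n + (i : ℕ) < L then _ else if L + 1 + k * n + (i : ℕ) = L then _ else
      _) = _
    rw [if_neg (by omega), if_neg (by omega)]
    simp only [h1, h2, h3]
  refine ⟨x, mem_rightEndpoints_of_blocks hc hn hnL (fun i hi => if_pos hi) ?_ fun k => ?_, hx⟩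
  · simpa [x] using hL
  · obtain ⟨y, hy, hyw⟩ := (w k).2
    exact IsBelow.congr hy fun i hi => congrFun ((hx k).trans hyw.symm) ⟨i, hi⟩

/-! ### Bounds ending in zeros -/

/-- A finite nonzero `c`, with last nonzero letter at position `K`, has the same `M_c'`
as the periodic sequence `b` whose period is `c 0, …, c (K - 1), c K - 1`, apart
from sequences with a shift equal to `c`. -/
theorem exists_periodic_of_finite {c : ShiftSpace m} (hc : ∀ n, shift^[n] c ≤ c) {K : ℕ}
    (hK : 0 < c K) (hzero : ∀ i, K < i → c i = 0) :
    ∃ b : ShiftSpace m, (∀ n, shift^[n] b ≤ b) ∧ b ≤ c ∧ (∀ i k, b (i + k * (K + 1)) = b i) ∧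
      ∀ x ∈ invariantBelow c, x ∈ invariantBelow b ∨ ∃ n, shift^[n] x = c := by
  obtain ⟨d, hdc, hd⟩ : ∃ d, d < c K ∧ ∀ e < c K, e ≤ d := by
    refine ⟨⟨(c K : ℕ) - 1, by omega⟩, ?_, fun e he => ?_⟩
    · simp only [Fin.lt_def, Fin.val_zero] at hK ⊢
      omega
    · simp only [Fin.lt_def, Fin.le_def] at he ⊢
      omega
  let b : ShiftSpace m := fun i => if i % (K + 1) < K then c (i % (K + 1)) else d
  have hper : ∀ i k, b (i + k * (K + 1)) = b i := fun i k => by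
    simp only [b, Nat.add_mul_mod_self_right]
  have hb1 : ∀ k, ∀ r < K, b (k * (K + 1) + r) = c r := fun k r hr => by
    rw [add_comm (k * (K + 1)) r, hper]
    simp only [b, Nat.mod_eq_of_lt (show r < K + 1 by omega), hr, if_true]
  have hb2 : ∀ k, b (k * (K + 1) + K) = d := fun k => by
    rw [add_comm (k * (K + 1)) K, hper]
    simp only [b, Nat.mod_eq_of_lt (show K < K + 1 by omega), lt_irrefl, if_false]
  have hbc : ∀ n, shift^[n] b < c := by
    intro n
    have hdm := Nat.div_add_mod' n (K + 1)
    obtain ⟨j, -, heq, hlt⟩ := exists_lt_of_lowered (y := shift^[n / (K + 1) * (K + 1)] b)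
      (p := n % (K + 1)) hc (fun i hi => by rw [shift_iterate_apply, hb1 _ _ hi])
      (by rwa [shift_iterate_apply, hb2]) (Nat.lt_succ_iff.1 (Nat.mod_lt _ K.succ_pos))
    simp only [shift_iterate_apply, ← add_assoc, hdm] at heq hlt
    refine (lt_iff _ _).2 ⟨j, fun l hl => ?_, ?_⟩
    · rw [shift_iterate_apply, heq l hl]
    · rwa [shift_iterate_apply]
  have hmax : ∀ x : ShiftSpace m, (∀ n, shift^[n] x < c) → x ≤ b := by
    intro x hx
    refine le_of_forall_apply_le fun j hj => ?_
    have hdm := Nat.div_add_mod' j (K + 1)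
    have hr := Nat.mod_lt j K.succ_pos
    set k := j / (K + 1)
    set r := j % (K + 1)
    have hagree : ∀ l < r, x (k * (K + 1) + l) = c l := fun l hl => by
      rw [hj _ (by omega), hb1 _ _ (by omega)]
    have hle := apply_le_of_le (hx (k * (K + 1))).le (j := r) fun l hl => by
      rw [shift_iterate_apply, hagree l hl]
    rw [shift_iterate_apply] at hle
    rw [← hdm]
    rcases Nat.lt_succ_iff_lt_or_eq.1 hr with h | h
    · rwa [hb1 _ _ h]
    · rw [h] at hle hagree ⊢
      rw [hb2]
      refine hd _ (lt_of_le_of_ne hle fun he => ?_)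
      -- agreement with `c` through its last nonzero letter excludes being smaller than `c`
      obtain ⟨i, -, hlt⟩ := (lt_iff _ _).1 (hx (k * (K + 1)))
      rw [shift_iterate_apply] at hlt
      rcases lt_trichotomy i K with hi | rfl | hi
      · exact hlt.ne (hagree i hi)
      · exact hlt.ne he
      · rw [hzero i hi] at hlt
        exact absurd hlt (not_lt.2 (Fin.zero_le _))
  have hmax' : ∀ x : ShiftSpace m, (∀ n, shift^[n] x < c) → ∀ n, shift^[n] x ≤ b := by
    refine fun x hx n => hmax _ fun k => ?_
    rw [← Function.iterate_add_apply]
    exact hx _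
  refine ⟨b, hmax' b hbc, (hbc 0).le, hper, fun x hx => ?_⟩
  by_cases h : ∃ n, shift^[n] x = c
  · exact Or.inr h
  · push Not at h
    exact Or.inl (hmax' x fun n => lt_of_le_of_ne (hx n) (h n))

theorem countable_setOf_exists_shift_eq (c : ShiftSpace m) :
    {x : ShiftSpace m | ∃ n, shift^[n] x = c}.Countable := by
  rw [Set.ofPred_exists]
  refine Set.countable_iUnion fun n => Set.Finite.countable ?_
  refine Set.Finite.of_finite_image (f := take n) (Set.toFinite _) fun x hx y hy hxy => ?_
  funext i
  rcases Nat.lt_or_ge i n with hi | hi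
  · exact congrFun hxy ⟨i, hi⟩
  · obtain ⟨l, rfl⟩ := Nat.exists_eq_add_of_le hi
    rw [← shift_iterate_apply n x, ← shift_iterate_apply n y]
    exact congrArg (fun z : ShiftSpace m => z l) (hx.trans hy.symm)

theorem hausdorffDim_invariantBelow_of_eq_zero {lam : ℝ} (hlam : 1 < lam) {c : ShiftSpace m}
    (hc : ∀ i, c i = 0) : hausdorffDim hlam (invariantBelow c) = 0 := by
  let := metric m hlam
  have h : ∀ x ∈ invariantBelow c, ∀ i, x i = 0 := fun x hx i => by
    have := apply_le_of_le (hx i) (j := 0) (by simp)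
    rw [shift_iterate_apply, hc] at this
    exact Fin.le_zero_iff.1 this
  exact dimH_subsingleton fun x hx y hy => funext fun i => (h x hx i).trans (h y hy i).symm

theorem hausdorffDim_mono {lam : ℝ} (hlam : 1 < lam) {A B : Set (ShiftSpace m)} (h : A ⊆ B) :
    hausdorffDim hlam A ≤ hausdorffDim hlam B :=
  letI := metric m hlam
  dimH_mono h

theorem hausdorffDim_invariantBelow_le_rightEndpoints {lam : ℝ} (hlam : 1 < lam)
    {c : ShiftSpace m} (hc : ∀ n, shift^[n] c ≤ c) :
    hausdorffDim hlam (invariantBelow c) ≤ hausdorffDim hlam (rightEndpoints c) := by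
  by_cases hinf : ∀ n, ∃ L, n ≤ L ∧ 0 < c L
  · exact hausdorffDim_invariantBelow_le_of_frequently hlam hc hinf
  by_cases h0 : ∀ i, c i = 0
  · rw [hausdorffDim_invariantBelow_of_eq_zero hlam h0]
    exact zero_le
  push Not at hinf h0
  obtain ⟨n, hn⟩ := hinf
  have hbound : ∀ i, c i ≠ 0 → i ≤ n := fun i hi => by
    by_contra! hni
    exact hi (Fin.le_zero_iff.1 (hn i hni.le))
  classical
  obtain ⟨i₀, hi₀⟩ := h0
  obtain ⟨K, hK, hzero⟩ : ∃ K, c K ≠ 0 ∧ ∀ i, K < i → c i = 0 := by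
    refine ⟨_, Nat.findGreatest_spec (P := fun i => c i ≠ 0) (hbound i₀ hi₀) hi₀, fun i hi => ?_⟩
    by_contra hne
    exact absurd (Nat.le_findGreatest (P := fun i => c i ≠ 0) (hbound i hne) hne) (not_le.2 hi)
  obtain ⟨b, hself, hle, hper, hsub⟩ :=
    exists_periodic_of_finite hc (Fin.pos_iff_ne_zero.2 hK) hzero
  have hdim : hausdorffDim hlam (invariantBelow c) ≤ hausdorffDim hlam (invariantBelow b) := by
    let := metric m hlam
    calc dimH (invariantBelow c)
        ≤ dimH (invariantBelow b ∪ {x | ∃ n, shift^[n] x = c}) := dimH_mono hsub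
      _ = dimH (invariantBelow b) := by
          rw [dimH_union, dimH_countable (countable_setOf_exists_shift_eq c), max_eq_left zero_le]
  by_cases hb0 : ∀ i, b i = 0
  · rw [hausdorffDim_invariantBelow_of_eq_zero hlam hb0] at hdim
    exact hdim.trans zero_le
  push Not at hb0
  obtain ⟨i, hi⟩ := hb0
  refine hdim.trans ((hausdorffDim_invariantBelow_le_of_frequently hlam hself fun k =>
    ⟨i + k * (K + 1), ?_, ?_⟩).trans (hausdorffDim_mono hlam fun x hx => ⟨hx.1, hx.2.trans hle⟩))
  · exact le_add_of_le_right (Nat.le_mul_of_pos_right k (Nat.succ_pos _))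
  · rw [hper]
    exact Fin.pos_iff_ne_zero.2 hi

end ShiftSpace

theorem mainTheorem5 (m : ℕ) (lam : ℝ) (hlam : 1 < lam) (c : ShiftSpace m) :
    ShiftSpace.hausdorffDim hlam (ShiftSpace.rightEndpoints c) =
      ShiftSpace.hausdorffDim hlam (ShiftSpace.invariantBelow c) := by
  obtain ⟨c', hself, hright, hinv⟩ := ShiftSpace.exists_selfMaximal c
  rw [← hright, ← hinv]
  exact le_antisymm
    (ShiftSpace.hausdorffDim_mono hlam (ShiftSpace.rightEndpoints_subset_invariantBelow c'))
    (ShiftSpace.hausdorffDim_invariantBelow_le_rightEndpoints hlam hself)
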